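/- Let $k$ be a field of characteristic zero and let $W=k^2$ be the standard representation of $\mathrm{GL}(2)$, with standard basis $e_1,e_2$. Let $V_1=\mathrm{Sym}^4 W$ with basis $m_i=e_1^{4-i}e_2^{i}$ $(0\le i\le 4)$ and $V_2=\mathrm{Sym}^2 W$ with basis $l_i=e_1^{2-i}e_2^{i}$ $(0\le i\le 2)$. Let $G=\mathrm{GL}(V_1)\times \mathrm{GL}(V_2)\cong \mathrm{GL}(5)\times\mathrm{GL}(3)$ act in the natural way on $V=\wedge^2V_1\otimes V_2$, and let $$w=(m_1\wedge m_4-3\,m_2\wedge m_3)\otimes l_0+(-m_0\wedge m_4+2\,m_1\wedge m_3)\otimes l_1+(m_0\wedge m_3-3\,m_1\wedge m_2)\otimes l_2\in V.$$ Let $G_w\subset G$ be the stabilizer of $w$, an algebraic group over $k$. The actions $g\mapsto (\det g)^{-2}\,\mathrm{Sym}^4 g$ on $V_1$ and $g\mapsto(\det g)^{-1}\,\mathrm{Sym}^2 g$ on $V_2$ define a homomorphism $\mathrm{GL}(2)\to G$ that is trivial on scalar matrices, hence a homomorphism $\rho:\mathrm{PGL}(2)\to G$. Let $\tilde T=\{(tI_5,t^{-2}I_3)\mid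 t\in \mathrm{GL}(1)\}\cong \mathrm{GL}(1)$, a central subgroup of $G$. Then: (1) $G_w$ is connected. (2) $\rho$ is an embedding and, regarding $\mathrm{PGL}(2)$ as a subgroup of $G$ by $\rho$, one has $G_w=\mathrm{PGL}(2)\times\tilde T\cong \mathrm{PGL}(2)\times \mathrm{GL}(1)$ as algebraic groups over $k$. That is, for every commutative $k$-algebra $R$, the homomorphism $\mathrm{GL}(2,R)/R^\times\to G(R)$ induced by $\rho$ is injective, and $(x,t)\mapsto x\cdot(tI_5,t^{-2}I_3)$ is an isomorphism from $\mathrm{PGL}(2)(R)\times R^\times$ onto $G_w(R)$. Here $\mathrm{PGL}(2)(R)\subset G(R)$ is the group of elements whose image in $G(R_{\mathfrak p})$ comes from $\mathrm{GL}(2,R_{\mathfrak p})$ for every prime ideal $\mathfrak p$ of $R$; when $R$ is a field or a local ring, it is the image of $\mathrm{GL}(2,R)/R^\times$. -/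

import Mathlib

open Matrix MatrixGroups

namespace PVS

/-! ### The prehomogeneous vector space `G = GL(5) × GL(3)`, `V = ⋀² k⁵ ⊗ k³`

Algebraic groups over `k` are handled through their functors of points on commutative rings.
`V₁ = Sym⁴ W` has the basis `m₀, …, m₄` with `mᵢ = e₁^(4-i) e₂^i`, and `V₂ = Sym² W` has the basis
`l₀, l₁, l₂` with `lᵢ = e₁^(2-i) e₂^i`, where `W` is the standard representation of `GL(2)`. -/

/-- The `R`-points of `G = GL(V₁) × GL(V₂) = GL(5) × GL(3)`. -/
abbrev G (R : Type*) [CommRing R] : Type _ := GL (Fin 5) R × GL (Fin 3) R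

/-- Functoriality of `G` in the ring. -/
def G.map {R S : Type*} [CommRing R] [CommRing S] (f : R →+* S) : G R →* G S :=
  (GeneralLinearGroup.map (n := Fin 5) f).prodMap (GeneralLinearGroup.map (n := Fin 3) f)

/-- The `R`-points of `V = ⋀² V₁ ⊗ V₂`, as alternating `5 × 5` matrices with entries in `V₂`:
`x` stands for `∑ c, x c ⊗ l_c`, where an alternating matrix `a` stands for
`∑ i < j, a i j • (mᵢ ∧ mⱼ)` in `⋀² V₁`. -/
def V (R : Type*) [CommRing R] : Submodule R (Fin 3 → Matrix (Fin 5) (Fin 5) R) where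
  carrier := {x | ∀ c i, x c i i = 0 ∧ ∀ j, x c j i = - x c i j}
  add_mem' := by
    intro a b ha hb c i
    refine ⟨by simp [(ha c i).1, (hb c i).1], fun j => ?_⟩
    simp only [Pi.add_apply, Matrix.add_apply, (ha c i).2 j, (hb c i).2 j]
    ring
  zero_mem' := by intro c i; simp
  smul_mem' := by
    intro r a ha c i
    refine ⟨by simp [(ha c i).1], fun j => ?_⟩
    simp [(ha c i).2 j]

/-- The formula for the natural action of `G` on `⋀² V₁ ⊗ V₂`: `g₁` acts on an alternating matrix
`a` by `g₁ a g₁ᵀ` (so `mᵢ ∧ mⱼ ↦ g₁ mᵢ ∧ g₁ mⱼ`), and `g₂` acts on the factor `V₂`. -/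
def act {R : Type*} [CommRing R] (g : G R) (x : Fin 3 → Matrix (Fin 5) (Fin 5) R) :
    Fin 3 → Matrix (Fin 5) (Fin 5) R :=
  fun c => ∑ d, g.2.val c d • (g.1.val * x d * g.1.valᵀ)

theorem act_mem {R : Type*} [CommRing R] (g : G R) {x : Fin 3 → Matrix (Fin 5) (Fin 5) R}
    (hx : x ∈ V R) : act g x ∈ V R := by
  have key : ∀ (P a : Matrix (Fin 5) (Fin 5) R), (∀ i, a i i = 0 ∧ ∀ j, a j i = - a i j) →
      ∀ i, (P * a * Pᵀ) i i = 0 ∧ ∀ j, (P * a * Pᵀ) j i = - (P * a * Pᵀ) i j := by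
    intro P a ha i
    constructor
    · have h0 := fun i => (ha i).1
      have h10 := (ha 0).2 1
      have h20 := (ha 0).2 2
      have h30 := (ha 0).2 3
      have h40 := (ha 0).2 4
      have h21 := (ha 1).2 2
      have h31 := (ha 1).2 3
      have h41 := (ha 1).2 4
      have h32 := (ha 2).2 3
      have h42 := (ha 2).2 4
      have h43 := (ha 3).2 4
      simp only [Matrix.mul_apply, Matrix.transpose_apply, Fin.sum_univ_five, h0, h10, h20, h30,
        h40, h21, h31, h41, h32, h42, h43]
      ring
    · intro j
      have hT : aᵀ = -a := by
        ext r s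
        simp [(ha r).2 s]
      have h2 : (P * a * Pᵀ)ᵀ = -(P * a * Pᵀ) := by
        simp [Matrix.transpose_mul, hT, Matrix.mul_assoc]
      simpa using congrFun (congrFun h2 i) j
  intro c i
  have hk := fun d => key g.1.val (x d) (hx d)
  constructor
  · simp only [act, Matrix.sum_apply, Matrix.smul_apply, (hk _ i).1, smul_zero,
      Finset.sum_const_zero]
  · intro j
    simp only [act, Matrix.sum_apply, Matrix.smul_apply, (hk _ i).2 j, smul_neg,
      Finset.sum_neg_distrib]

instance instMulAction (R : Type*) [CommRing R] : MulAction (G R) (V R) where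
  smul g x := ⟨act g x.1, act_mem g x.2⟩
  one_smul x := by
    apply Subtype.ext
    funext c
    change act 1 x.1 c = x.1 c
    simp [act, Matrix.one_apply]
  mul_smul g h x := by
    apply Subtype.ext
    funext c
    change act (g * h) x.1 c = act g (act h x.1) c
    simp only [act, Prod.snd_mul, Prod.fst_mul, Units.val_mul, Matrix.mul_apply (M := g.2.val),
      Matrix.mul_sum, Matrix.sum_mul, Finset.smul_sum, Finset.sum_smul, Matrix.mul_smul,
      Matrix.smul_mul, smul_smul, Matrix.transpose_mul, Matrix.mul_assoc]
    rw [Finset.sum_comm]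

/-- The element `mᵢ ∧ mⱼ` of `⋀² V₁`, as an alternating matrix. -/
def wedge (R : Type*) [CommRing R] (i j : Fin 5) : Matrix (Fin 5) (Fin 5) R :=
  Matrix.single i j 1 - Matrix.single j i 1

/-- The point
`w = (m₁∧m₄ - 3 m₂∧m₃) ⊗ l₀ + (-m₀∧m₄ + 2 m₁∧m₃) ⊗ l₁ + (m₀∧m₃ - 3 m₁∧m₂) ⊗ l₂`. -/
def wMat (R : Type*) [CommRing R] : Fin 3 → Matrix (Fin 5) (Fin 5) R :=
  ![wedge R 1 4 - (3 : R) • wedge R 2 3,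
    -wedge R 0 4 + (2 : R) • wedge R 1 3,
    wedge R 0 3 - (3 : R) • wedge R 1 2]

theorem wMat_mem (R : Type*) [CommRing R] : wMat R ∈ V R := by
  intro c i
  fin_cases c <;>
  · refine ⟨by fin_cases i <;> simp [wMat, wedge], fun j => ?_⟩
    fin_cases i <;> fin_cases j <;> simp [wMat, wedge]

/-- The point `w`, as an element of `V`. -/
def w (R : Type*) [CommRing R] : V R := ⟨wMat R, wMat_mem R⟩

/-- The `R`-points of the stabilizer `G_w`. -/
abbrev stab (R : Type*) [CommRing R] : Subgroup (G R) := MulAction.stabilizer (G R) (w R)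

/-! ### The coordinate ring of `G_w` -/

/-- Names of the matrix entries of `(g₁, g₂)`. -/
abbrev Idx : Type := (Fin 5 × Fin 5) ⊕ (Fin 3 × Fin 3)

/-- The `5 × 5` matrix of indeterminates. -/
noncomputable def genMat₁ (k : Type*) [CommRing k] :
    Matrix (Fin 5) (Fin 5) (MvPolynomial Idx k) :=
  Matrix.of fun i j => MvPolynomial.X (Sum.inl (i, j))

/-- The `3 × 3` matrix of indeterminates. -/
noncomputable def genMat₂ (k : Type*) [CommRing k] :
    Matrix (Fin 3) (Fin 3) (MvPolynomial Idx k) :=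
  Matrix.of fun i j => MvPolynomial.X (Sum.inr (i, j))

/-- The coordinate ring `k[G]` of `GL(5) × GL(3)`. -/
abbrev CoordG (k : Type*) [CommRing k] : Type _ :=
  Localization.Away ((genMat₁ k).det * (genMat₂ k).det)

theorem isUnit_det_gen (k : Type*) [CommRing k] :
    IsUnit ((genMat₁ k).map (algebraMap _ (CoordG k))).det ∧
      IsUnit ((genMat₂ k).map (algebraMap _ (CoordG k))).det := by
  have h : IsUnit (algebraMap (MvPolynomial Idx k) (CoordG k)
      ((genMat₁ k).det * (genMat₂ k).det)) :=
    IsLocalization.Away.algebraMap_isUnit _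
  rw [map_mul, RingHom.map_det, RingHom.map_det] at h
  exact ⟨isUnit_of_mul_isUnit_left h, isUnit_of_mul_isUnit_right h⟩

/-- The generic (universal) point of `G`, with values in `k[G]`. -/
noncomputable def genG (k : Type*) [CommRing k] : G (CoordG k) :=
  (GeneralLinearGroup.mk'' _ (isUnit_det_gen k).1, GeneralLinearGroup.mk'' _ (isUnit_det_gen k).2)

/-- The ideal of the closed subscheme `G_w` of `G`: it is generated by the coordinates of
`g w - w` for the generic `g`. -/
noncomputable def stabIdeal (k : Type*) [CommRing k] : Ideal (CoordG k) :=
  Ideal.span {f | ∃ c i j, f = (genG k • w (CoordG k)).1 c i j - (w (CoordG k)).1 c i j}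

/-- The coordinate ring `k[G_w]` of the stabilizer; the group scheme `G_w` is its spectrum. -/
abbrev CoordStab (k : Type*) [CommRing k] : Type _ := CoordG k ⧸ stabIdeal k

theorem act_map {R S : Type*} [CommRing R] [CommRing S] (f : R →+* S) (g : G R)
    (x : Fin 3 → Matrix (Fin 5) (Fin 5) R) (c : Fin 3) (i j : Fin 5) :
    act (G.map f g) (fun d => (x d).map f) c i j = f (act g x c i j) := by
  simp [act, G.map, Matrix.sum_apply, Matrix.mul_apply, map_sum, map_mul]

theorem wMat_map {R S : Type*} [CommRing R] [CommRing S] (f : R →+* S) (c : Fin 3) :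
    (wMat R c).map f = wMat S c := by
  ext i j
  fin_cases c <;> simp [wMat, wedge, Matrix.single_apply] <;> split_ifs <;> simp [map_ofNat]

/-- `k[G]` represents the functor `R ↦ G(R)` on commutative `k`-algebras. -/
theorem existsUnique_coordG (k : Type*) [CommRing k] {R : Type*} [CommRing R] [Algebra k R]
    (g : G R) : ∃! ψ : CoordG k →ₐ[k] R, G.map ψ.toRingHom (genG k) = g := by
  let v : Idx → R := Sum.elim (fun p => g.1.val p.1 p.2) (fun p => g.2.val p.1 p.2)
  have h1 : (genMat₁ k).map (MvPolynomial.aeval v : MvPolynomial Idx k →ₐ[k] R) = g.1.val := by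
    ext i j
    simp [genMat₁, v]
  have h2 : (genMat₂ k).map (MvPolynomial.aeval v : MvPolynomial Idx k →ₐ[k] R) = g.2.val := by
    ext i j
    simp [genMat₂, v]
  have hd1 : (MvPolynomial.aeval v : MvPolynomial Idx k →ₐ[k] R) (genMat₁ k).det = g.1.val.det := by
    rw [← h1]
    exact AlgHom.map_det _ _
  have hd2 : (MvPolynomial.aeval v : MvPolynomial Idx k →ₐ[k] R) (genMat₂ k).det = g.2.val.det := by
    rw [← h2]
    exact AlgHom.map_det _ _
  have hu : ∀ y : Submonoid.powers ((genMat₁ k).det * (genMat₂ k).det),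
      IsUnit ((MvPolynomial.aeval v : MvPolynomial Idx k →ₐ[k] R) y) := by
    rintro ⟨_, n, rfl⟩
    simp only [map_pow, map_mul, hd1, hd2]
    exact (((Matrix.isUnit_iff_isUnit_det _).1 g.1.isUnit).mul
      ((Matrix.isUnit_iff_isUnit_det _).1 g.2.isUnit)).pow n
  refine ⟨IsLocalization.liftAlgHom (M := Submonoid.powers ((genMat₁ k).det * (genMat₂ k).det))
    (f := MvPolynomial.aeval v) hu, ?_, ?_⟩
  · refine Prod.ext (Units.ext ?_) (Units.ext ?_)
    · refine Eq.trans ?_ h1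
      ext i j
      exact IsLocalization.lift_eq _ _
    · refine Eq.trans ?_ h2
      ext i j
      exact IsLocalization.lift_eq _ _
  · intro ψ hψ
    have e1 : ∀ i j, ψ (algebraMap _ _ (genMat₁ k i j)) = g.1.val i j := fun i j =>
      congrFun (congrFun (congrArg (fun x : G R => x.1.val) hψ) i) j
    have e2 : ∀ i j, ψ (algebraMap _ _ (genMat₂ k i j)) = g.2.val i j := fun i j =>
      congrFun (congrFun (congrArg (fun x : G R => x.2.val) hψ) i) j
    refine IsLocalization.algHom_ext (Submonoid.powers ((genMat₁ k).det * (genMat₂ k).det)) ?_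
    refine MvPolynomial.algHom_ext fun t => ?_
    refine Eq.trans ?_ (IsLocalization.lift_eq _ _).symm
    rcases t with ⟨i, j⟩ | ⟨i, j⟩
    · exact (e1 i j).trans (by simp [v])
    · exact (e2 i j).trans (by simp [v])

theorem mem_stab_map_iff (k : Type*) [CommRing k] {R : Type*} [CommRing R]
    (f : CoordG k →+* R) : G.map f (genG k) ∈ stab R ↔ stabIdeal k ≤ RingHom.ker f := by
  have key : ∀ c i j, f ((genG k • w (CoordG k)).1 c i j - (w (CoordG k)).1 c i j) =
      act (G.map f (genG k)) (wMat R) c i j - wMat R c i j := by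
    intro c i j
    have e : wMat R = fun d => (wMat (CoordG k) d).map f := funext fun d => (wMat_map f d).symm
    rw [e, act_map, map_sub]
    rfl
  rw [stabIdeal, Ideal.span_le, MulAction.mem_stabilizer_iff]
  constructor
  · rintro h _ ⟨c, i, j, rfl⟩
    have h' : act (G.map f (genG k)) (wMat R) = wMat R := congrArg Subtype.val h
    rw [SetLike.mem_coe, RingHom.mem_ker, key, h', sub_self]
  · intro h
    refine Subtype.ext ?_
    change act (G.map f (genG k)) (wMat R) = wMat R
    ext c i j
    have := h ⟨c, i, j, rfl⟩
    rw [SetLike.mem_coe, RingHom.mem_ker, key, sub_eq_zero] at this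
    exact this

/-- `k[G_w]` represents the functor `R ↦ G_w(R)` on commutative `k`-algebras. -/
theorem mem_stab_iff (k : Type*) [CommRing k] {R : Type*} [CommRing R] [Algebra k R] (g : G R) :
    g ∈ stab R ↔ ∃! φ : CoordStab k →ₐ[k] R,
      G.map (φ.comp (Ideal.Quotient.mkₐ k (stabIdeal k))).toRingHom (genG k) = g := by
  obtain ⟨ψ, hψ, huniq⟩ := existsUnique_coordG k g
  constructor
  · intro hg
    have hk : stabIdeal k ≤ RingHom.ker ψ.toRingHom := by
      rw [← mem_stab_map_iff]
      rwa [hψ]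
    have hk' : ∀ a ∈ stabIdeal k, ψ a = 0 := fun a ha => RingHom.mem_ker.1 (hk ha)
    have hc : (Ideal.Quotient.liftₐ (stabIdeal k) ψ hk').comp
        (Ideal.Quotient.mkₐ k (stabIdeal k)) = ψ := Ideal.Quotient.liftₐ_comp _ _ _
    refine ⟨Ideal.Quotient.liftₐ (stabIdeal k) ψ hk', ?_, ?_⟩
    · change G.map (AlgHom.toRingHom (AlgHom.comp _ _)) _ = _
      rw [hc]
      exact hψ
    · intro φ hφ
      refine Ideal.Quotient.algHom_ext k ?_
      exact (huniq _ hφ).trans hc.symm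
  · rintro ⟨φ, hφ, -⟩
    rw [← hφ, mem_stab_map_iff]
    intro a ha
    rw [RingHom.mem_ker]
    have : Ideal.Quotient.mkₐ k (stabIdeal k) a = 0 := Ideal.Quotient.eq_zero_iff_mem.2 ha
    change φ (Ideal.Quotient.mkₐ k (stabIdeal k) a) = 0
    rw [this, map_zero]

/-! ### The subgroups `PGL(2)` and `T̃ ≅ GL(1)` of `G` -/

/-- The matrix of `Sym² g` in the basis `e₁², e₁e₂, e₂²`; see `sym2Mat_spec`. -/
def sym2Mat {R : Type*} [CommRing R] (g : Matrix (Fin 2) (Fin 2) R) : Matrix (Fin 3) (Fin 3) R :=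
  let a := g 0 0
  let b := g 0 1
  let c := g 1 0
  let d := g 1 1
  !![a ^ 2, a * b, b ^ 2;
     2 * a * c, a * d + b * c, 2 * b * d;
     c ^ 2, c * d, d ^ 2]

/-- The matrix of `Sym⁴ g` in the basis `e₁⁴, e₁³e₂, e₁²e₂², e₁e₂³, e₂⁴`; see `sym4Mat_spec`. -/
def sym4Mat {R : Type*} [CommRing R] (g : Matrix (Fin 2) (Fin 2) R) : Matrix (Fin 5) (Fin 5) R :=
  let a := g 0 0
  let b := g 0 1
  let c := g 1 0
  let d := g 1 1
  !![a ^ 4, a ^ 3 * b, a ^ 2 * b ^ 2, a * b ^ 3, b ^ 4;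
     4 * a ^ 3 * c, a ^ 3 * d + 3 * a ^ 2 * b * c, 2 * a ^ 2 * b * d + 2 * a * b ^ 2 * c,
       3 * a * b ^ 2 * d + b ^ 3 * c, 4 * b ^ 3 * d;
     6 * a ^ 2 * c ^ 2, 3 * a ^ 2 * c * d + 3 * a * b * c ^ 2,
       a ^ 2 * d ^ 2 + 4 * a * b * c * d + b ^ 2 * c ^ 2,
       3 * a * b * d ^ 2 + 3 * b ^ 2 * c * d, 6 * b ^ 2 * d ^ 2;
     4 * a * c ^ 3, 3 * a * c ^ 2 * d + b * c ^ 3, 2 * a * c * d ^ 2 + 2 * b * c ^ 2 * d,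
       a * d ^ 3 + 3 * b * c * d ^ 2, 4 * b * d ^ 3;
     c ^ 4, c ^ 3 * d, c ^ 2 * d ^ 2, c * d ^ 3, d ^ 4]

/-- The `j`-th column of `sym2Mat g` holds the coordinates of `(g e₁)^(2-j) (g e₂)^j`, where
`g e₁ = g₀₀ e₁ + g₁₀ e₂` and `g e₂ = g₀₁ e₁ + g₁₁ e₂`. -/
theorem sym2Mat_spec {R : Type*} [CommRing R] (g : Matrix (Fin 2) (Fin 2) R) (j : Fin 3)
    {A : Type*} [CommRing A] [Algebra R A] (e₁ e₂ : A) :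
    ∑ i : Fin 3, algebraMap R A (sym2Mat g i j) * (e₁ ^ (2 - i.val) * e₂ ^ i.val) =
      (algebraMap R A (g 0 0) * e₁ + algebraMap R A (g 1 0) * e₂) ^ (2 - j.val) *
        (algebraMap R A (g 0 1) * e₁ + algebraMap R A (g 1 1) * e₂) ^ j.val := by
  fin_cases j <;> simp [sym2Mat, Fin.sum_univ_three, map_ofNat] <;> ring

/-- The `j`-th column of `sym4Mat g` holds the coordinates of `(g e₁)^(4-j) (g e₂)^j`. -/
theorem sym4Mat_spec {R : Type*} [CommRing R] (g : Matrix (Fin 2) (Fin 2) R) (j : Fin 5)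
    {A : Type*} [CommRing A] [Algebra R A] (e₁ e₂ : A) :
    ∑ i : Fin 5, algebraMap R A (sym4Mat g i j) * (e₁ ^ (4 - i.val) * e₂ ^ i.val) =
      (algebraMap R A (g 0 0) * e₁ + algebraMap R A (g 1 0) * e₂) ^ (4 - j.val) *
        (algebraMap R A (g 0 1) * e₁ + algebraMap R A (g 1 1) * e₂) ^ j.val := by
  fin_cases j <;> simp [sym4Mat, Fin.sum_univ_five, map_ofNat] <;> ring

/-- `Sym²` as a homomorphism of monoids. -/
def sym2 (R : Type*) [CommRing R] : Matrix (Fin 2) (Fin 2) R →* Matrix (Fin 3) (Fin 3) R where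
  toFun := sym2Mat
  map_one' := by
    ext i j
    fin_cases i <;> fin_cases j <;> simp [sym2Mat]
  map_mul' g h := by
    ext i j
    fin_cases i <;> fin_cases j <;>
      simp [sym2Mat, Matrix.mul_apply, Fin.sum_univ_two, Fin.sum_univ_three] <;> ring

/-- `Sym⁴` as a homomorphism of monoids. -/
def sym4 (R : Type*) [CommRing R] : Matrix (Fin 2) (Fin 2) R →* Matrix (Fin 5) (Fin 5) R where
  toFun := sym4Mat
  map_one' := by
    ext i j
    fin_cases i <;> fin_cases j <;> simp [sym4Mat]
  map_mul' g h := by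
    ext i j
    fin_cases i <;> fin_cases j <;>
      simp [sym4Mat, Matrix.mul_apply, Fin.sum_univ_two, Fin.sum_univ_five] <;> ring

/-- The homomorphism `GL(2) → G` given by the twisted actions
`g ↦ (det g)⁻² Sym⁴ g` on `V₁` and `g ↦ (det g)⁻¹ Sym² g` on `V₂`. -/
def rho (R : Type*) [CommRing R] : GL (Fin 2) R →* G R where
  toFun g :=
    (GeneralLinearGroup.scalar (Fin 5) ((GeneralLinearGroup.det g)⁻¹ ^ 2) * Units.map (sym4 R) g,
      GeneralLinearGroup.scalar (Fin 3) (GeneralLinearGroup.det g)⁻¹ * Units.map (sym2 R) g)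
  map_one' := by simp
  map_mul' g h := by
    ext1
    · simp only [map_mul, mul_inv, mul_pow, Prod.mk_mul_mk]
      rw [mul_assoc, mul_assoc, ← mul_assoc (Units.map (sym4 R) g),
        ← GeneralLinearGroup.scalar_commute]
      simp only [mul_assoc]
    · simp only [map_mul, mul_inv, Prod.mk_mul_mk]
      rw [mul_assoc, mul_assoc, ← mul_assoc (Units.map (sym2 R) g),
        ← GeneralLinearGroup.scalar_commute]
      simp only [mul_assoc]

theorem rho_scalar (R : Type*) [CommRing R] :
    (rho R).comp (GeneralLinearGroup.scalar (Fin 2)) = 1 := by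
  have h4 : ∀ u : Rˣ, Units.map (sym4 R) (GeneralLinearGroup.scalar (Fin 2) u) =
      GeneralLinearGroup.scalar (Fin 5) (u ^ 4) := by
    intro u
    ext i j
    fin_cases i <;> fin_cases j <;> simp [sym4, sym4Mat, Matrix.diagonal_pow] <;> ring
  have h2 : ∀ u : Rˣ, Units.map (sym2 R) (GeneralLinearGroup.scalar (Fin 2) u) =
      GeneralLinearGroup.scalar (Fin 3) (u ^ 2) := by
    intro u
    ext i j
    fin_cases i <;> fin_cases j <;> simp [sym2, sym2Mat, Matrix.diagonal_pow] <;> ring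
  refine MonoidHom.ext fun u => Prod.ext ?_ ?_
  · change GeneralLinearGroup.scalar (Fin 5) _ * Units.map (sym4 R) _ = 1
    rw [h4, ← map_mul, GeneralLinearGroup.det_scalar, Fintype.card_fin, inv_pow, ← pow_mul,
      inv_mul_cancel, map_one]
  · change GeneralLinearGroup.scalar (Fin 3) _ * Units.map (sym2 R) _ = 1
    rw [h2, ← map_mul, GeneralLinearGroup.det_scalar, Fintype.card_fin, inv_mul_cancel, map_one]

/-- The induced homomorphism `PGL(2, R) = GL(2, R) / center → G(R)`. -/
def rhoPGL (R : Type*) [CommRing R] : PGL(2, R) →* G R :=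
  ProjGenLinGroup.lift (rho R) (rho_scalar R)

theorem rhoPGL_map {R S : Type*} [CommRing R] [CommRing S] (f : R →+* S) (x : PGL(2, R)) :
    G.map f (rhoPGL R x) = rhoPGL S (ProjGenLinGroup.map f x) := by
  induction x using ProjGenLinGroup.induction_on with
  | mk g =>
    have e4 : GeneralLinearGroup.map f (Units.map (sym4 R) g) =
        Units.map (sym4 S) (GeneralLinearGroup.map f g) := by
      ext i j
      fin_cases i <;> fin_cases j <;> simp [sym4, sym4Mat, map_ofNat]
    have e2 : GeneralLinearGroup.map f (Units.map (sym2 R) g) =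
        Units.map (sym2 S) (GeneralLinearGroup.map f g) := by
      ext i j
      fin_cases i <;> fin_cases j <;> simp [sym2, sym2Mat, map_ofNat]
    refine Prod.ext ?_ ?_
    · change GeneralLinearGroup.map f
        (GeneralLinearGroup.scalar (Fin 5) _ * Units.map (sym4 R) g) =
          GeneralLinearGroup.scalar (Fin 5) _ * Units.map (sym4 S) (GeneralLinearGroup.map f g)
      rw [map_mul, e4, GeneralLinearGroup.map_scalar, GeneralLinearGroup.map_det, map_pow, map_inv]
    · change GeneralLinearGroup.map f
        (GeneralLinearGroup.scalar (Fin 3) _ * Units.map (sym2 R) g) =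
          GeneralLinearGroup.scalar (Fin 3) _ * Units.map (sym2 S) (GeneralLinearGroup.map f g)
      rw [map_mul, e2, GeneralLinearGroup.map_scalar, GeneralLinearGroup.map_det, map_inv]

/-- The `R`-points of the algebraic subgroup `PGL(2)` of `G`, for an arbitrary commutative ring `R`.
The group scheme `PGL(2) = GL(2) / GL(1)` is the Zariski sheaf associated with
`R ↦ GL(2, R) / Rˣ`, so a point of `G(R)` lies in `PGL(2)` exactly when it comes from
`PGL(2, R_p) = GL(2, R_p) / R_pˣ` at every prime `p` of `R`. Over fields, and more generally over
local rings, it is just the image of `PGL(2, R)`: see `pgl2_eq_range`. -/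
def pgl2 (R : Type*) [CommRing R] : Subgroup (G R) :=
  ⨅ p : PrimeSpectrum R,
    (rhoPGL (Localization.AtPrime p.asIdeal)).range.comap
      (G.map (algebraMap R (Localization.AtPrime p.asIdeal)))

/-- Over a local ring (for example a field) the points of `PGL(2)` are the image of `PGL(2, R)`. -/
theorem pgl2_eq_range (R : Type*) [CommRing R] [IsLocalRing R] : pgl2 R = (rhoPGL R).range := by
  apply le_antisymm
  · intro g hg
    obtain ⟨y, hy⟩ := (Subgroup.mem_iInf.1 hg) (IsLocalRing.closedPoint R)
    let e := IsLocalization.atUnits R (IsLocalRing.closedPoint R).asIdeal.primeCompl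
      (S := Localization.AtPrime (IsLocalRing.closedPoint R).asIdeal)
      (by
        intro x hx
        by_contra h
        exact hx ((IsLocalRing.mem_maximalIdeal x).2 h))
    let f : Localization.AtPrime (IsLocalRing.closedPoint R).asIdeal →+* R :=
      e.symm.toRingEquiv.toRingHom
    refine ⟨ProjGenLinGroup.map f y, ?_⟩
    rw [← rhoPGL_map, hy]
    have hf : ∀ r, f (algebraMap R _ r) = r := fun r => e.symm.commutes r
    refine Prod.ext (Units.ext ?_) (Units.ext ?_) <;>
    · ext i j
      exact hf _
  · rintro _ ⟨x, rfl⟩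
    refine Subgroup.mem_iInf.2 fun p => ?_
    exact ⟨ProjGenLinGroup.map _ x, (rhoPGL_map _ x).symm⟩

/-- The homomorphism `GL(1) → G`, `t ↦ (t I₅, t⁻² I₃)`, whose image is `T̃ = ker (G → GL(V))`. -/
def torus (R : Type*) [CommRing R] : Rˣ →* G R where
  toFun t := (GeneralLinearGroup.scalar (Fin 5) t, GeneralLinearGroup.scalar (Fin 3) (t⁻¹ ^ 2))
  map_one' := by simp
  map_mul' s t := by simp [mul_pow, mul_comm]

theorem torus_commute {R : Type*} [CommRing R] (g : G R) (t : Rˣ) : Commute g (torus R t) :=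
  Prod.ext (GeneralLinearGroup.scalar_commute _ _).symm
    (GeneralLinearGroup.scalar_commute _ _).symm

/-- The multiplication homomorphism `PGL(2) × GL(1) → G`, `(x, t) ↦ x · (t I₅, t⁻² I₃)`,
on `R`-points. -/
def prodHom (R : Type*) [CommRing R] : pgl2 R × Rˣ →* G R :=
  MonoidHom.noncommCoprod (pgl2 R).subtype (torus R) fun x t => torus_commute x.1 t

end PVS

/-! Regard `w` as a net of alternating forms on a 5-dimensional space. The 4 × 4 sub-Pfaffians give
a symmetric bilinear map on the net with values in ⋀⁴V₁ ≅ V₁* ⊗ det, hence a linear map from a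
6-dimensional space of quadratic expressions to a 5-dimensional one. For `w` it is onto (6 being
invertible), and its kernel is spanned by the relation pf(w₁,w₁) = 4 pf(w₀,w₂). The Pfaffians are
covariant (`transpose_mulVec_pf`), so a stabilizing pair (g₁, g₂) preserves this line: g₂ is a
similitude of the discriminant x₁² - 4x₀x₂ of binary quadratic forms (`conic_of_mem_stab`).

Over a local ring such similitudes are scalar multiples of Sym² h with h in GL(2). Dividing by ρ(h),
which fixes `w` by `act_sym`, leaves a scalar g₂. Then g₁ᵀ multiplies all Pfaffians by one scalar,
so g₁ is scalar too, and fixing `w` puts the pair in the torus (`exists_torus_of_snd_eq_smul_one`).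
This gives `exists_of_mem_stab`.

For general R the character `invDet`, trivial on ρ and the identity on the torus, determines the
torus factor globally, so membership of the other factor in PGL(2) can be checked at each prime. For
connectedness, the map GL(2) × GL(1) → G_w is onto on spectra, because every point over a residue
field lifts over that same field, and its source is the spectrum of a domain. -/

namespace PVS

/-! ### Pfaffians of a net of alternating forms -/

/-- Twice the polarised `4 × 4` sub-Pfaffians of the antisymmetrisations of `A` and `B`. -/
def pf {R : Type*} [CommRing R] (A B : Matrix (Fin 5) (Fin 5) R) : Fin 5 → R :=
  let p : Fin 5 → Fin 5 → Fin 5 → Fin 5 → R := fun i j k l =>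
    (A i j - A j i) * (B k l - B l k) - (A i k - A k i) * (B j l - B l j) +
      (A i l - A l i) * (B j k - B k j) + (A j k - A k j) * (B i l - B l i) -
      (A j l - A l j) * (B i k - B k i) + (A k l - A l k) * (B i j - B j i)
  ![p 1 2 3 4, -p 0 2 3 4, p 0 1 3 4, -p 0 1 2 4, p 0 1 2 3]

/-- On decomposable bivectors the pairing with `pf` is z ∧ u ∧ v ∧ x ∧ y. This turns covariance into
multiplicativity of the determinant. -/
theorem dotProduct_pf_vecMulVec {R : Type*} [CommRing R] (z u v x y : Fin 5 → R) :
    z ⬝ᵥ pf (vecMulVec u v) (vecMulVec x y) = (Matrix.of ![z, u, v, x, y]).det := by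
  simp only [pf, vecMulVec_apply, dotProduct, Matrix.det_succ_row_zero (n := 4),
    Matrix.det_succ_row_zero (n := 3), Matrix.det_fin_three, Fin.sum_univ_succ,
    Matrix.submatrix_apply]
  simp [Fin.succAbove, Fin.lt_def]
  ring

theorem pf_add_left {R : Type*} [CommRing R] (A A' B : Matrix (Fin 5) (Fin 5) R) :
    pf (A + A') B = pf A B + pf A' B := by
  ext i
  fin_cases i <;> simp [pf] <;> ring

theorem pf_smul_left {R : Type*} [CommRing R] (r : R) (A B : Matrix (Fin 5) (Fin 5) R) :
    pf (r • A) B = r • pf A B := by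
  ext i
  fin_cases i <;> simp [pf] <;> ring

theorem pf_comm {R : Type*} [CommRing R] (A B : Matrix (Fin 5) (Fin 5) R) :
    pf A B = pf B A := by
  ext i
  fin_cases i <;> simp [pf] <;> ring

theorem pf_add_right {R : Type*} [CommRing R] (A B B' : Matrix (Fin 5) (Fin 5) R) :
    pf A (B + B') = pf A B + pf A B' := by
  rw [pf_comm, pf_add_left, pf_comm B, pf_comm B']

theorem pf_smul_right {R : Type*} [CommRing R] (r : R) (A B : Matrix (Fin 5) (Fin 5) R) :
    pf A (r • B) = r • pf A B := by
  rw [pf_comm, pf_smul_left, pf_comm B]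

/-- The vector of Pfaffians is covariant: it transforms under `P` by the cofactor matrix. -/
theorem transpose_mulVec_pf {R : Type*} [CommRing R] (P A B : Matrix (Fin 5) (Fin 5) R) :
    Pᵀ *ᵥ pf (P * A * Pᵀ) (P * B * Pᵀ) = P.det • pf A B := by
  -- Both sides are bilinear in A and B, and matrix units have rank one. Since `pf` antisymmetrises
  -- its arguments, they need not be alternating, so rank-one matrices suffice.
  have hdec : ∀ u v x y : Fin 5 → R,
      Pᵀ *ᵥ pf (P * vecMulVec u v * Pᵀ) (P * vecMulVec x y * Pᵀ) =
        P.det • pf (vecMulVec u v) (vecMulVec x y) := by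
    intro u v x y
    refine dotProduct_eq _ _ fun z => ?_
    rw [dotProduct_comm, dotProduct_comm _ z, dotProduct_smul, dotProduct_pf_vecMulVec,
      dotProduct_mulVec, vecMul_transpose, mul_vecMulVec, mul_vecMulVec, vecMulVec_mul,
      vecMulVec_mul, vecMul_transpose, vecMul_transpose, dotProduct_pf_vecMulVec, smul_eq_mul,
      mul_comm, ← Matrix.det_transpose P, ← Matrix.det_mul]
    congr 1
    ext i j
    fin_cases i <;> simp [Matrix.mul_apply, mulVec, dotProduct, mul_comm]
  have hadd : ∀ A A' : Matrix (Fin 5) (Fin 5) R,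
      P * (A + A') * Pᵀ = P * A * Pᵀ + P * A' * Pᵀ := fun A A' => by
    rw [Matrix.mul_add, Matrix.add_mul]
  induction A using Matrix.induction_on with
  | h_add A A' hA hA' =>
    rw [hadd, pf_add_left, pf_add_left, mulVec_add, hA, hA', smul_add]
  | h_std_basis i j a =>
    induction B using Matrix.induction_on with
    | h_add B B' hB hB' =>
      rw [hadd, pf_add_right, pf_add_right, mulVec_add, hB, hB', smul_add]
    | h_std_basis k l b =>
      have hs : ∀ (i j : Fin 5) (a : R), single i j a =
          vecMulVec (a • Pi.single i 1) (Pi.single j 1) := fun i j a => by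
        rw [smul_vecMulVec, ← single_eq_single_vecMulVec_single, smul_single, smul_eq_mul, mul_one]
      rw [hs, hs]
      exact hdec _ _ _ _

/-- Only mᵢ ∧ mⱼ with i + j = 5 - c occur in w_c, so pf(w_c, w_c') is supported at the index c + c'.
All constants are units once 6 is, so every basis vector is reached, and the only coincidence, c +
c' = 2, yields the conic. -/
theorem pf_wMat (R : Type*) [CommRing R] :
    pf (wMat R 0) (wMat R 0) = Pi.single 0 (-24) ∧
    pf (wMat R 0) (wMat R 1) = Pi.single 1 (-12) ∧
    pf (wMat R 0) (wMat R 2) = Pi.single 2 (-4) ∧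
    pf (wMat R 1) (wMat R 1) = Pi.single 2 (-16) ∧
    pf (wMat R 1) (wMat R 2) = Pi.single 3 (-12) ∧
    pf (wMat R 2) (wMat R 2) = Pi.single 4 (-24) := by
  refine ⟨?_, ?_, ?_, ?_, ?_, ?_⟩ <;>
  · ext i
    fin_cases i <;> simp [pf, wMat, wedge] <;> norm_num

/-! ### Invariance of `w` under PGL(2) and the torus -/

theorem conj_wedge {R : Type*} [CommRing R] (P : Matrix (Fin 5) (Fin 5) R) (i j a b : Fin 5) :
    (P * wedge R i j * Pᵀ) a b = P a i * P b j - P a j * P b i := by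
  simp only [wedge, Matrix.mul_sub, Matrix.sub_mul, Matrix.sub_apply]
  rw [Matrix.mul_assoc, Matrix.mul_assoc]
  simp [Matrix.mul_apply, Matrix.single_apply, ite_and]

theorem conj_wMat {R : Type*} [CommRing R] (P : Matrix (Fin 5) (Fin 5) R) (a b : Fin 5) :
    (P * wMat R 0 * Pᵀ) a b =
        P a 1 * P b 4 - P a 4 * P b 1 - 3 * (P a 2 * P b 3 - P a 3 * P b 2) ∧
      (P * wMat R 1 * Pᵀ) a b =
        -(P a 0 * P b 4 - P a 4 * P b 0) + 2 * (P a 1 * P b 3 - P a 3 * P b 1) ∧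
      (P * wMat R 2 * Pᵀ) a b =
        P a 0 * P b 3 - P a 3 * P b 0 - 3 * (P a 1 * P b 2 - P a 2 * P b 1) := by
  simp only [← conj_wedge]
  refine ⟨?_, ?_, ?_⟩ <;> simp [wMat, Matrix.mul_sub, Matrix.sub_mul, Matrix.mul_add, Matrix.add_mul]

-- `w` spans a one-dimensional GL(2)-subrepresentation of ⋀²Sym⁴ ⊗ Sym². Its degree is 4 + 4 + 2 =
-- 10, whence the character det⁵, which the twists by det⁻² (used twice) and det⁻¹ in ρ cancel.
set_option maxHeartbeats 2000000 in
theorem act_sym {R : Type*} [CommRing R] (h : Matrix (Fin 2) (Fin 2) R) (c : Fin 3) :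
    ∑ d, sym2Mat h c d • (sym4Mat h * wMat R d * (sym4Mat h)ᵀ) = h.det ^ 5 • wMat R c := by
  have hs : ∀ i j, sym2Mat h c 0 * (sym4Mat h * wMat R 0 * (sym4Mat h)ᵀ) i j +
      sym2Mat h c 1 * (sym4Mat h * wMat R 1 * (sym4Mat h)ᵀ) i j +
      sym2Mat h c 2 * (sym4Mat h * wMat R 2 * (sym4Mat h)ᵀ) i j = h.det ^ 5 * wMat R c i j := by
    intro i j
    rw [(conj_wMat _ i j).1, (conj_wMat _ i j).2.1, (conj_wMat _ i j).2.2, Matrix.det_fin_two]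
    fin_cases c <;> fin_cases i <;> fin_cases j <;>
      simp [wMat, wedge, sym2Mat, sym4Mat] <;> ring
  ext i j
  rw [Fin.sum_univ_three]
  exact hs i j

theorem mem_stab_iff_act {R : Type*} [CommRing R] {g : G R} :
    g ∈ stab R ↔ act g (wMat R) = wMat R :=
  MulAction.mem_stabilizer_iff.trans Subtype.ext_iff

theorem rho_fst_val {R : Type*} [CommRing R] (h : GL (Fin 2) R) :
    (rho R h).1.val = ((h.det⁻¹ ^ 2 : Rˣ) : R) • sym4Mat h.val :=
  (smul_eq_diagonal_mul _ _).symm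

theorem rho_snd_val {R : Type*} [CommRing R] (h : GL (Fin 2) R) :
    (rho R h).2.val = ((h.det⁻¹ : Rˣ) : R) • sym2Mat h.val :=
  (smul_eq_diagonal_mul _ _).symm

theorem torus_fst_val {R : Type*} [CommRing R] (t : Rˣ) :
    (torus R t).1.val = (t : R) • 1 := (smul_one_eq_diagonal _).symm

theorem torus_snd_val {R : Type*} [CommRing R] (t : Rˣ) :
    (torus R t).2.val = ((t⁻¹ ^ 2 : Rˣ) : R) • 1 := (smul_one_eq_diagonal _).symm

theorem rho_mem_stab {R : Type*} [CommRing R] (h : GL (Fin 2) R) : rho R h ∈ stab R := by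
  rw [mem_stab_iff_act]
  funext c
  have e : h.val.det = (h.det : R) := rfl
  simp only [act, rho_fst_val, rho_snd_val, Matrix.smul_apply, transpose_smul, Matrix.smul_mul,
    Matrix.mul_smul, smul_smul, smul_eq_mul]
  have := congrArg (fun x => ((h.det⁻¹ ^ 5 : Rˣ) : R) • x) (act_sym h.val c)
  simp only [Finset.smul_sum, smul_smul, e, ← Units.val_pow_eq_pow_val, ← Units.val_mul] at this
  rw [inv_pow, inv_mul_cancel, Units.val_one, one_smul] at this
  rw [← this]
  refine Finset.sum_congr rfl fun d _ => ?_
  congr 1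
  push_cast
  ring

theorem torus_mem_stab {R : Type*} [CommRing R] (t : Rˣ) : torus R t ∈ stab R := by
  rw [mem_stab_iff_act]
  funext c
  simp only [act, torus_fst_val, torus_snd_val, Matrix.smul_apply, transpose_smul, Matrix.smul_mul,
    Matrix.mul_smul, smul_smul, smul_eq_mul, transpose_one, Matrix.one_mul,
    Matrix.one_apply, mul_ite, mul_zero, ite_mul, zero_mul, ite_smul, zero_smul,
    Finset.sum_ite_eq, Finset.mem_univ, if_true, mul_one]
  rw [← Units.val_mul, ← Units.val_mul, inv_pow, ← sq, inv_mul_cancel, Units.val_one,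
    one_smul]

/-! ### The conic attached to the net, and the scalar case -/

/-- The transformation law of the Pfaffians of the net `w` under an element of the stabilizer. -/
theorem transpose_mulVec_pf_wMat {R : Type*} [CommRing R] {g : G R} (hg : g ∈ stab R)
    (c c' : Fin 3) :
    g.1.valᵀ *ᵥ pf (wMat R c) (wMat R c') =
      g.1.val.det • ∑ d, ∑ d', (g.2.val c d * g.2.val c' d') • pf (wMat R d) (wMat R d') := by
  have hw := mem_stab_iff_act.1 hg
  have h1 := congrFun hw c
  have h2 := congrFun hw c'
  simp only [act, Fin.sum_univ_three] at h1 h2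
  conv_lhs => rw [← h1, ← h2]
  simp only [pf_add_left, pf_add_right, pf_smul_left, pf_smul_right, mulVec_add, mulVec_smul,
    transpose_mulVec_pf, Fin.sum_univ_three]
  module

theorem sum_pf_wMat (R : Type*) [CommRing R] (M : Fin 3 → Fin 3 → R) :
    ∑ d, ∑ d', M d d' • pf (wMat R d) (wMat R d') =
      ![-24 * M 0 0, -12 * (M 0 1 + M 1 0), -4 * (M 0 2 + M 2 0 + 4 * M 1 1),
        -12 * (M 1 2 + M 2 1), -24 * M 2 2] := by
  obtain ⟨h00, h01, h02, h11, h12, h22⟩ := pf_wMat R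
  simp only [Fin.sum_univ_three, pf_comm (wMat R 1) (wMat R 0), pf_comm (wMat R 2) (wMat R 0),
    pf_comm (wMat R 2) (wMat R 1), h00, h01, h02, h11, h12, h22]
  ext i
  fin_cases i <;> simp <;> ring

/-- An element of the stabilizer preserves the conic spanning the kernel of the Pfaffian map. -/
theorem conic_of_mem_stab {R : Type*} [CommRing R] (h6 : IsUnit (6 : R)) {g : G R}
    (hg : g ∈ stab R) :
    g.2.val 1 0 ^ 2 = 4 * (g.2.val 0 0 * g.2.val 2 0) ∧
    g.2.val 1 0 * g.2.val 1 1 = 2 * (g.2.val 0 0 * g.2.val 2 1 + g.2.val 0 1 * g.2.val 2 0) ∧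
    g.2.val 1 0 * g.2.val 1 2 - 2 * (g.2.val 0 0 * g.2.val 2 2 + g.2.val 0 2 * g.2.val 2 0) =
      -2 * (g.2.val 1 1 ^ 2 - 4 * (g.2.val 0 1 * g.2.val 2 1)) ∧
    g.2.val 1 1 * g.2.val 1 2 = 2 * (g.2.val 0 1 * g.2.val 2 2 + g.2.val 0 2 * g.2.val 2 1) ∧
    g.2.val 1 2 ^ 2 = 4 * (g.2.val 0 2 * g.2.val 2 2) := by
  have h2 : IsUnit (2 : R) := isUnit_of_dvd_unit ⟨3, by norm_num⟩ h6
  have hdet : IsUnit g.1.val.det := (Matrix.isUnit_iff_isUnit_det _).1 g.1.isUnit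
  have e11 := transpose_mulVec_pf_wMat hg 1 1
  have e02 := transpose_mulVec_pf_wMat hg 0 2
  obtain ⟨-, -, h02, h11, -, -⟩ := pf_wMat R
  -- This is the kernel of the Pfaffian map. Applying g₁ᵀ to both sides and cancelling the unit det
  -- g₁ gives the same relation for the transformed net; its five coordinates are the claims.
  have h4 : pf (wMat R 1) (wMat R 1) = (4 : R) • pf (wMat R 0) (wMat R 2) := by
    rw [h02, h11, ← Pi.single_smul]
    norm_num
  rw [h4, mulVec_smul, e02, smul_comm] at e11
  have e := (hdet.smul_left_cancel).1 e11
  rw [sum_pf_wMat, sum_pf_wMat] at e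
  have c0 := congrFun e 0
  have c1 := congrFun e 1
  have c2 := congrFun e 2
  have c3 := congrFun e 3
  have c4 := congrFun e 4
  simp at c0 c1 c2 c3 c4
  have h24 : IsUnit (24 : R) := by
    have := (h2.mul h2).mul h6
    norm_num at this
    exact this
  refine ⟨h24.mul_left_cancel ?_, h24.mul_left_cancel ?_, ((h2.mul h2).mul h2).mul_left_cancel ?_,
    h24.mul_left_cancel ?_, h24.mul_left_cancel ?_⟩
  · linear_combination -c0
  · linear_combination -c1
  · linear_combination -c2
  · linear_combination -c3
  · linear_combination -c4

/-- An element of the stabilizer which is scalar on `V₂` lies in the torus. -/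
theorem exists_torus_of_snd_eq_smul_one {R : Type*} [CommRing R] (h6 : IsUnit (6 : R)) {g : G R}
    (hg : g ∈ stab R) {s : R} (hs : g.2.val = s • 1) : ∃ t, g = torus R t := by
  have h2 : IsUnit (2 : R) := isUnit_of_dvd_unit ⟨3, by norm_num⟩ h6
  have h4 : IsUnit (4 : R) := by
    have := h2.mul h2
    norm_num at this
    exact this
  have h12 : IsUnit (12 : R) := by
    have := h2.mul h6
    norm_num at this
    exact this
  have h24 : IsUnit (24 : R) := by
    have := h4.mul h6
    norm_num at this
    exact this
  set μ := g.1.val.det * (s * s) with hμ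
  have key : ∀ c c', g.1.valᵀ *ᵥ pf (wMat R c) (wMat R c') = μ • pf (wMat R c) (wMat R c') := by
    intro c c'
    rw [transpose_mulVec_pf_wMat hg, hs]
    fin_cases c <;> fin_cases c' <;> simp [Fin.sum_univ_three, smul_smul, hμ]
  -- A Pfaffian equal to a unit times the i-th basis vector determines the i-th row of g₁.
  have hcol : ∀ (n : R) (i : Fin 5), IsUnit n →
      g.1.valᵀ *ᵥ Pi.single i (-n) = μ • Pi.single i (-n) →
      ∀ j, g.1.val i j = (μ • (1 : Matrix (Fin 5) (Fin 5) R)) i j := by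
    intro n i hn h j
    have h' := congrFun h j
    rw [mulVec_single] at h'
    refine hn.neg.mul_left_cancel ?_
    simp only [Pi.smul_apply, MulOpposite.smul_eq_mul_unop, MulOpposite.unop_op, col_apply,
      transpose_apply, smul_eq_mul, Pi.single_apply] at h'
    rw [mul_comm, h', Matrix.smul_apply, Matrix.one_apply, smul_eq_mul]
    simp only [eq_comm (a := j)]
    split_ifs <;> ring
  obtain ⟨h00, h01, h02, -, h12', h22⟩ := pf_wMat R
  have hP : g.1.val = μ • (1 : Matrix (Fin 5) (Fin 5) R) := by
    ext i
    fin_cases i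
    · exact hcol 24 0 h24 (h00 ▸ key 0 0) _
    · exact hcol 12 1 h12 (h01 ▸ key 0 1) _
    · exact hcol 4 2 h4 (h02 ▸ key 0 2) _
    · exact hcol 12 3 h12 (h12' ▸ key 1 2) _
    · exact hcol 24 4 h24 (h22 ▸ key 2 2) _
  -- The term m₀ ∧ m₃ ⊗ l₂ has coefficient 1 in `w`, so comparing it before and after acting gives
  -- μ²s = 1, the equation of the torus.
  have hw := congrFun (congrFun (congrFun (mem_stab_iff_act.1 hg) 2) 0) 3
  simp only [act, hP, hs, Fin.sum_univ_three] at hw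
  simp [wMat, wedge] at hw
  have hμs : μ * μ * s = 1 := by linear_combination hw
  have hu : IsUnit μ := IsUnit.of_mul_eq_one (μ * s) (by rw [← mul_assoc, hμs])
  refine ⟨hu.unit, Prod.ext (Units.ext ?_) (Units.ext ?_)⟩
  · rw [torus_fst_val, hP]
    rfl
  · rw [torus_snd_val, hs]
    congr 1
    rw [inv_pow]
    refine (Units.inv_eq_of_mul_eq_one_right ?_).symm
    rw [Units.val_pow_eq_pow_val, IsUnit.unit_spec, sq, hμs]

/-! ### Similitudes of the conic over a local ring -/

theorem exists_torus_of_snd_eq_smul_rho {R : Type*} [CommRing R] (h6 : IsUnit (6 : R)) {g : G R}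
    (hg : g ∈ stab R) (h : GL (Fin 2) R) {s : R} (hs : g.2.val = s • (rho R h).2.val) :
    ∃ t, g = rho R h * torus R t := by
  have hg' : (rho R h)⁻¹ * g ∈ stab R := mul_mem (inv_mem (rho_mem_stab h)) hg
  obtain ⟨t, ht⟩ := exists_torus_of_snd_eq_smul_one h6 hg' (s := s) (by
    rw [Prod.snd_mul, Prod.snd_inv, Units.val_mul, hs, Matrix.mul_smul, Units.inv_mul])
  exact ⟨t, by rw [← ht, mul_inv_cancel_left]⟩

/-- The Borel case: the isotropic line of l₀ is preserved, and the conic equations then force g₂ to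
be upper triangular and determined by g₀₀, g₀₁ and g₁₁. -/
theorem exists_of_snd_upper {R : Type*} [CommRing R] (h6 : IsUnit (6 : R)) {g : G R}
    (hg : g ∈ stab R) (h00 : IsUnit (g.2.val 0 0)) (h10 : g.2.val 1 0 = 0) :
    ∃ h t, g = rho R h * torus R t := by
  have h2 : IsUnit (2 : R) := isUnit_of_dvd_unit ⟨3, by norm_num⟩ h6
  obtain ⟨e0, e1, e2, e3, e4⟩ := conic_of_mem_stab h6 hg
  have hdet : IsUnit g.2.val.det := (Matrix.isUnit_iff_isUnit_det _).1 g.2.isUnit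
  rw [Matrix.det_fin_three] at hdet
  obtain ⟨s, hs⟩ := h00
  rw [h10, ← hs] at e0 e1 e2 hdet
  have h20 : g.2.val 2 0 = 0 := (h2.mul h2).mul_left_cancel (s.isUnit.mul_left_cancel (by
    linear_combination -e0))
  rw [h20] at e1 e2 hdet
  have h21 : g.2.val 2 1 = 0 := h2.mul_left_cancel (s.isUnit.mul_left_cancel (by
    linear_combination -e1))
  rw [h21] at e2 e3 hdet
  have h22 : s * g.2.val 2 2 = g.2.val 1 1 ^ 2 := h2.mul_left_cancel (by linear_combination -e2)
  have h11 : IsUnit (g.2.val 1 1) := isUnit_of_dvd_unit ⟨s * g.2.val 2 2, by ring⟩ hdet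
  have h12 : s * g.2.val 1 2 = 2 * (g.2.val 0 1 * g.2.val 1 1) := h11.mul_left_cancel (by
    linear_combination s * e3 + 2 * g.2.val 0 1 * h22)
  have h02 : s * g.2.val 0 2 = g.2.val 0 1 ^ 2 :=
    ((h2.mul h2).mul (h11.pow 2)).mul_left_cancel (by
      linear_combination s ^ 2 * -e4 + (s * g.2.val 1 2 + 2 * (g.2.val 0 1 * g.2.val 1 1)) * h12
        - 4 * s * g.2.val 0 2 * h22)
  -- Chosen so that Sym² A = s g₂, where s = g₀₀: the first row of Sym² A is (s², s g₀₁, g₀₁²).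
  let A : Matrix (Fin 2) (Fin 2) R := !![(s : R), g.2.val 0 1; 0, g.2.val 1 1]
  have hA : IsUnit A.det := by
    simp only [A, det_fin_two_of, mul_zero, sub_zero]
    exact s.isUnit.mul h11
  let h : GL (Fin 2) R := GeneralLinearGroup.mk'' A hA
  refine ⟨h, exists_torus_of_snd_eq_smul_rho h6 hg h (s := (s⁻¹ : Rˣ) * (h.det : R)) ?_⟩
  rw [rho_snd_val, smul_smul, mul_assoc, Units.mul_inv, mul_one]
  refine Matrix.ext fun i j => s.isUnit.mul_left_cancel ?_
  rw [Matrix.smul_apply, smul_eq_mul, Units.mul_inv_cancel_left]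
  change _ = sym2Mat A i j
  fin_cases i <;> fin_cases j <;> simp [sym2Mat, A, ← hs, h10, h20, h21, h22, h12, h02] <;> ring

/-- The lower unipotent element with parameter -c, c = g₁₀ / (2 g₀₀), clears the entry g₁₀ and keeps
g₀₀, which reduces to the Borel case. -/
theorem exists_of_isUnit_snd {R : Type*} [CommRing R] (h6 : IsUnit (6 : R)) {g : G R}
    (hg : g ∈ stab R) (h00 : IsUnit (g.2.val 0 0)) :
    ∃ h t, g = rho R h * torus R t := by
  have h2 : IsUnit (2 : R) := isUnit_of_dvd_unit ⟨3, by norm_num⟩ h6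
  obtain ⟨c, hc⟩ := (h2.mul h00).dvd (a := g.2.val 1 0)
  let A : Matrix (Fin 2) (Fin 2) R := !![1, 0; -c, 1]
  have hA : A.det = 1 := by simp [A]
  let n : GL (Fin 2) R := GeneralLinearGroup.mk'' A (hA ▸ isUnit_one)
  have hn : n.det = 1 := Units.ext hA
  have hv : (rho R n * g).2.val = sym2Mat A * g.2.val := by
    rw [Prod.snd_mul, Units.val_mul, rho_snd_val, hn, inv_one, Units.val_one, one_smul]
    rfl
  obtain ⟨h, t, e⟩ := exists_of_snd_upper h6 (mul_mem (rho_mem_stab n) hg)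
    (by rw [hv]; simpa [Matrix.mul_apply, Fin.sum_univ_three, sym2Mat, A] using h00)
    (by
      rw [hv]
      simp [Matrix.mul_apply, Fin.sum_univ_three, sym2Mat, A]
      linear_combination hc)
  exact ⟨n⁻¹ * h, t, by rw [map_mul, mul_assoc, ← e, map_inv, inv_mul_cancel_left]⟩

/-- Over a local ring the stabilizer is generated by the images of `GL(2)` and `GL(1)`. -/
theorem exists_of_mem_stab {R : Type*} [CommRing R] [IsLocalRing R] (h6 : IsUnit (6 : R)) {g : G R}
    (hg : g ∈ stab R) : ∃ h t, g = rho R h * torus R t := by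
  by_cases h00 : IsUnit (g.2.val 0 0)
  · exact exists_of_isUnit_snd h6 hg h00
  by_cases h20 : IsUnit (g.2.val 2 0)
  · let A : Matrix (Fin 2) (Fin 2) R := !![0, 1; -1, 0]
    have hA : A.det = 1 := by simp [A]
    let n : GL (Fin 2) R := GeneralLinearGroup.mk'' A (hA ▸ isUnit_one)
    have hn : n.det = 1 := Units.ext hA
    have hv : (rho R n * g).2.val = sym2Mat A * g.2.val := by
      rw [Prod.snd_mul, Units.val_mul, rho_snd_val, hn, inv_one, Units.val_one, one_smul]
      rfl
    obtain ⟨h, t, e⟩ := exists_of_isUnit_snd h6 (mul_mem (rho_mem_stab n) hg)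
      (by rw [hv]; simpa [Matrix.mul_apply, Fin.sum_univ_three, sym2Mat, A] using h20)
    exact ⟨n⁻¹ * h, t, by rw [map_mul, mul_assoc, ← e, map_inv, inv_mul_cancel_left]⟩
  -- If neither g₀₀ nor g₂₀ is a unit, then g₁₀² = 4 g₀₀ g₂₀ puts the whole first column in the
  -- maximal ideal, against invertibility of g₂.
  exfalso
  have e0 := (conic_of_mem_stab h6 hg).1
  have hdet : IsUnit g.2.val.det := (Matrix.isUnit_iff_isUnit_det _).1 g.2.isUnit
  have m00 := (IsLocalRing.mem_maximalIdeal _).2 h00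
  have m20 := (IsLocalRing.mem_maximalIdeal _).2 h20
  have m10 : g.2.val 1 0 ∈ IsLocalRing.maximalIdeal R := by
    refine (IsLocalRing.maximalIdeal.isMaximal R).isPrime.mem_of_pow_mem 2 ?_
    rw [e0]
    exact Ideal.mul_mem_left _ _ (Ideal.mul_mem_left _ _ m20)
  refine (IsLocalRing.mem_maximalIdeal _).1 ?_ hdet
  have : g.2.val.det = (g.2.val 1 1 * g.2.val 2 2 - g.2.val 1 2 * g.2.val 2 1) * g.2.val 0 0 +
      (g.2.val 0 2 * g.2.val 2 1 - g.2.val 0 1 * g.2.val 2 2) * g.2.val 1 0 +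
      (g.2.val 0 1 * g.2.val 1 2 - g.2.val 0 2 * g.2.val 1 1) * g.2.val 2 0 := by
    rw [Matrix.det_fin_three]
    ring
  rw [this]
  exact add_mem (add_mem (Ideal.mul_mem_left _ _ m00) (Ideal.mul_mem_left _ _ m10))
    (Ideal.mul_mem_left _ _ m20)

/-! ### Faithfulness of ρ and the splitting character -/

theorem det_sym2Mat {R : Type*} [CommRing R] (h : Matrix (Fin 2) (Fin 2) R) :
    (sym2Mat h).det = h.det ^ 3 := by
  simp [sym2Mat, Matrix.det_fin_three, Matrix.det_fin_two]
  ring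

set_option maxHeartbeats 2000000 in
theorem det_sym4Mat {R : Type*} [CommRing R] (h : Matrix (Fin 2) (Fin 2) R) :
    (sym4Mat h).det = h.det ^ 10 := by
  simp only [Matrix.det_succ_row_zero (n := 4),
    Matrix.det_succ_row_zero (n := 3), Matrix.det_fin_three, Fin.sum_univ_succ,
    Matrix.submatrix_apply, Matrix.det_fin_two h]
  simp [sym4Mat, Fin.succAbove, Fin.lt_def]
  ring

/-- The V₂ component already suffices: Sym² h = det h · I gives a² = ad + bc = det h and ab = 2ac =
0, so a is a unit and h is scalar. The entry 2ac is where 2 must be invertible. -/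
theorem rhoPGL_injective {R : Type*} [CommRing R] (h2 : IsUnit (2 : R)) :
    Function.Injective (rhoPGL R) := by
  rw [injective_iff_map_eq_one]
  intro x hx
  obtain ⟨h, rfl⟩ := ProjGenLinGroup.mk_surjective x
  have e : (rho R h).2.val = 1 := congrArg (fun g : G R => g.2.val) hx
  have hD : h.val.det = (h.det : R) := rfl
  have e' : sym2Mat h.val = (h.det : R) • (1 : Matrix (Fin 3) (Fin 3) R) := by
    rw [← e, rho_snd_val, smul_smul, Units.mul_inv, one_smul]
  have e00 := congrFun (congrFun e' 0) 0
  have e01 := congrFun (congrFun e' 0) 1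
  have e10 := congrFun (congrFun e' 1) 0
  have e11 := congrFun (congrFun e' 1) 1
  simp [sym2Mat] at e00 e01 e10 e11
  have ha : IsUnit (h.val 0 0) := (isUnit_pow_iff two_ne_zero).1 (e00 ▸ h.det.isUnit)
  have hb : h.val 0 1 = 0 := ha.mul_left_cancel (by rw [e01, mul_zero])
  have hc : h.val 1 0 = 0 := (h2.mul ha).mul_left_cancel (by rw [e10, mul_zero])
  have hd : h.val 0 0 = h.val 1 1 := ha.mul_left_cancel (by
    rw [hb, zero_mul, add_zero] at e11
    rw [e11, ← e00, sq])
  rw [ProjGenLinGroup.mk_eq_one, GeneralLinearGroup.mem_center_iff_val_mem_range_scalar]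
  refine ⟨h.val 0 0, ?_⟩
  ext i j
  fin_cases i <;> fin_cases j <;> simp [hb, hc, hd]

/-- The character `g ↦ (det g₁ det g₂)⁻¹` of `G`. -/
def invDet (R : Type*) [CommRing R] : G R →* Rˣ where
  toFun g := (g.1.det * g.2.det)⁻¹
  map_one' := by simp
  map_mul' g h := by
    simp only [Prod.fst_mul, Prod.snd_mul, map_mul]
    rw [← mul_inv, mul_mul_mul_comm]

theorem invDet_rho {R : Type*} [CommRing R] (h : GL (Fin 2) R) : invDet R (rho R h) = 1 := by
  refine inv_eq_one.2 ?_
  have h1 : (rho R h).1.det = 1 := by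
    ext
    change (rho R h).1.val.det = 1
    have e : h.val.det = (h.det : R) := rfl
    rw [rho_fst_val, Matrix.det_smul, det_sym4Mat, e, ← Units.val_pow_eq_pow_val,
      ← Units.val_pow_eq_pow_val, ← Units.val_mul, Fintype.card_fin, ← pow_mul, inv_pow,
      inv_mul_cancel, Units.val_one]
  have h2 : (rho R h).2.det = 1 := by
    ext
    change (rho R h).2.val.det = 1
    have e : h.val.det = (h.det : R) := rfl
    rw [rho_snd_val, Matrix.det_smul, det_sym2Mat, e, ← Units.val_pow_eq_pow_val,
      ← Units.val_pow_eq_pow_val, ← Units.val_mul, Fintype.card_fin, inv_pow,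
      inv_mul_cancel, Units.val_one]
  rw [h1, h2, one_mul]

/-- The determinants are t⁵ and t⁻⁶, so the inverse of their product is t. -/
theorem invDet_torus {R : Type*} [CommRing R] (t : Rˣ) : invDet R (torus R t) = t := by
  change (GeneralLinearGroup.det (GeneralLinearGroup.scalar (Fin 5) t) *
    GeneralLinearGroup.det (GeneralLinearGroup.scalar (Fin 3) (t⁻¹ ^ 2)))⁻¹ = t
  rw [GeneralLinearGroup.det_scalar, GeneralLinearGroup.det_scalar, Fintype.card_fin,
    Fintype.card_fin, inv_eq_iff_eq_inv]
  group

theorem invDet_map {R S : Type*} [CommRing R] [CommRing S] (f : R →+* S) (g : G R) :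
    invDet S (G.map f g) = Units.map f (invDet R g) := by
  change (GeneralLinearGroup.det (GeneralLinearGroup.map f g.1) *
    GeneralLinearGroup.det (GeneralLinearGroup.map f g.2))⁻¹ = _
  rw [GeneralLinearGroup.map_det, GeneralLinearGroup.map_det, ← map_mul, ← map_inv]
  rfl

/-! ### Base change and the product decomposition over arbitrary rings -/

theorem torus_map {R S : Type*} [CommRing R] [CommRing S] (f : R →+* S) (t : Rˣ) :
    G.map f (torus R t) = torus S (Units.map f t) := by
  refine Prod.ext ?_ ?_
  · exact GeneralLinearGroup.map_scalar _ _
  · refine (GeneralLinearGroup.map_scalar _ _).trans ?_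
    rw [map_pow, map_inv]
    rfl

theorem rho_map {R S : Type*} [CommRing R] [CommRing S] (f : R →+* S) (h : GL (Fin 2) R) :
    G.map f (rho R h) = rho S (GeneralLinearGroup.map f h) :=
  rhoPGL_map f (ProjGenLinGroup.mk h)

theorem map_mem_stab {R S : Type*} [CommRing R] [CommRing S] (f : R →+* S) {g : G R}
    (hg : g ∈ stab R) : G.map f g ∈ stab S := by
  rw [mem_stab_iff_act] at hg ⊢
  funext c
  ext i j
  rw [← funext (wMat_map f), act_map, hg]
  rfl

theorem eq_of_forall_localization {R : Type*} [CommRing R] {a b : R}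
    (h : ∀ p : PrimeSpectrum R, algebraMap R (Localization.AtPrime p.asIdeal) a =
      algebraMap R (Localization.AtPrime p.asIdeal) b) : a = b :=
  PrimeSpectrum.toPiLocalization_injective R (funext h)

theorem exists_of_mem_pgl2 {R : Type*} [CommRing R] {g : G R} (hg : g ∈ pgl2 R)
    (p : PrimeSpectrum R) :
    ∃ h, rho (Localization.AtPrime p.asIdeal) h = G.map (algebraMap R _) g := by
  obtain ⟨x, hx⟩ := Subgroup.mem_iInf.1 hg p
  obtain ⟨h, rfl⟩ := ProjGenLinGroup.mk_surjective x
  exact ⟨h, hx⟩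

theorem pgl2_le_stab (R : Type*) [CommRing R] : pgl2 R ≤ stab R := by
  intro g hg
  rw [mem_stab_iff_act]
  funext c
  ext i j
  refine eq_of_forall_localization fun p => ?_
  obtain ⟨h, hh⟩ := exists_of_mem_pgl2 hg p
  have := mem_stab_iff_act.1 (rho_mem_stab h)
  rw [hh] at this
  rw [← act_map, funext (wMat_map _), this, ← wMat_map (algebraMap R _)]
  rfl

theorem invDet_of_mem_pgl2 {R : Type*} [CommRing R] {g : G R} (hg : g ∈ pgl2 R) :
    invDet R g = 1 := by
  ext
  refine eq_of_forall_localization fun p => ?_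
  obtain ⟨h, hh⟩ := exists_of_mem_pgl2 hg p
  have e := invDet_rho h
  rw [hh, invDet_map] at e
  exact (congrArg Units.val e).trans (by simp)

theorem prodHom_apply {R : Type*} [CommRing R] (x : pgl2 R) (t : Rˣ) :
    prodHom R (x, t) = x.1 * torus R t := rfl

theorem prodHom_injective (R : Type*) [CommRing R] : Function.Injective (prodHom R) := by
  rw [injective_iff_map_eq_one]
  rintro ⟨x, t⟩ h
  rw [prodHom_apply] at h
  have ht : t = 1 := by
    have := congrArg (invDet R) h
    rwa [map_mul, invDet_of_mem_pgl2 x.2, invDet_torus, map_one, one_mul] at this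
  subst ht
  rw [map_one, mul_one] at h
  exact Prod.ext (Subtype.ext h) rfl

theorem range_prodHom {R : Type*} [CommRing R] (h6 : IsUnit (6 : R)) :
    (prodHom R).range = stab R := by
  apply le_antisymm
  · rintro _ ⟨⟨x, t⟩, rfl⟩
    exact mul_mem (pgl2_le_stab R x.2) (torus_mem_stab t)
  · intro g hg
    -- The torus factor must be `invDet R g`. At each prime the local decomposition has the same
    -- torus part, so the remaining factor is ρ(h) there.
    refine ⟨(⟨g * (torus R (invDet R g))⁻¹, Subgroup.mem_iInf.2 fun p => ?_⟩, invDet R g), ?_⟩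
    · have h6' : IsUnit (6 : Localization.AtPrime p.asIdeal) := by
        have := h6.map (algebraMap R (Localization.AtPrime p.asIdeal))
        rwa [map_ofNat] at this
      obtain ⟨h, t, e⟩ := exists_of_mem_stab h6' (map_mem_stab (algebraMap R _) hg)
      refine ⟨ProjGenLinGroup.mk h, ?_⟩
      have ht := invDet_map (algebraMap R (Localization.AtPrime p.asIdeal)) g
      rw [e, map_mul, invDet_rho, invDet_torus, one_mul] at ht
      rw [map_mul, map_inv, torus_map, ← ht, e, mul_inv_cancel_right]
      rfl
    · rw [prodHom_apply, inv_mul_cancel_right]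

/-! ### Connectedness of the stabilizer -/

/-- The determinant of the generic `2 × 2` matrix times one more indeterminate. -/
noncomputable def genDet (k : Type*) [CommRing k] : MvPolynomial (Option (Fin 2 × Fin 2)) k :=
  (Matrix.of fun i j => MvPolynomial.X (some (i, j))).det * MvPolynomial.X none

theorem aeval_genDet (k : Type*) [CommRing k] {R : Type*} [CommRing R] [Algebra k R]
    (M : Matrix (Fin 2) (Fin 2) R) (t : R) :
    MvPolynomial.aeval (fun o : Option (Fin 2 × Fin 2) => o.elim t fun p => M p.1 p.2) (genDet k) =
      M.det * t := by
  simp [genDet, Matrix.det_fin_two]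

theorem genDet_ne_zero (k : Type*) [CommRing k] [Nontrivial k] : genDet k ≠ 0 := by
  intro h
  have := aeval_genDet k (1 : Matrix (Fin 2) (Fin 2) k) 1
  rw [h] at this
  simp at this

/-- The coordinate ring of `GL(2) × GL(1)`. -/
abbrev CoordGLProd (k : Type*) [CommRing k] : Type _ := Localization.Away (genDet k)

theorem isDomain_coordGLProd (k : Type*) [Field k] : IsDomain (CoordGLProd k) :=
  IsLocalization.isDomain_localization (powers_le_nonZeroDivisors_of_noZeroDivisors
    (genDet_ne_zero k))

/-- The universal point of GL(2) × GL(1): every point over a k-algebra is a specialization of it. -/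
theorem exists_gen_coordGLProd (k : Type*) [CommRing k] :
    ∃ (h : GL (Fin 2) (CoordGLProd k)) (t : (CoordGLProd k)ˣ),
      ∀ (R : Type*) [CommRing R] [Algebra k R] (h' : GL (Fin 2) R) (t' : Rˣ),
        ∃ f : CoordGLProd k →ₐ[k] R,
          GeneralLinearGroup.map f.toRingHom h = h' ∧ Units.map f.toRingHom t = t' := by
  let ι := algebraMap (MvPolynomial (Option (Fin 2 × Fin 2)) k) (CoordGLProd k)
  let M : Matrix (Fin 2) (Fin 2) (CoordGLProd k) :=
    Matrix.of fun i j => ι (MvPolynomial.X (some (i, j)))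
  have hu : IsUnit (M.det * ι (MvPolynomial.X none)) := by
    have e : M.det * ι (MvPolynomial.X none) = ι (genDet k) := by
      rw [Matrix.det_fin_two]
      simp [M, ι, genDet, Matrix.det_fin_two]
    rw [e]
    exact IsLocalization.Away.algebraMap_isUnit _
  refine ⟨GeneralLinearGroup.mk'' M (isUnit_of_mul_isUnit_left hu),
    (isUnit_of_mul_isUnit_right hu).unit, fun R _ _ h' t' => ?_⟩
  let φ : MvPolynomial (Option (Fin 2 × Fin 2)) k →ₐ[k] R :=
    MvPolynomial.aeval fun o => o.elim (t' : R) fun p => h'.val p.1 p.2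
  have hφ : ∀ y : Submonoid.powers (genDet k), IsUnit (φ y) := by
    rintro ⟨_, n, rfl⟩
    simp only [map_pow]
    refine IsUnit.pow n ?_
    rw [aeval_genDet]
    exact ((Matrix.isUnit_iff_isUnit_det _).1 h'.isUnit).mul t'.isUnit
  have hl : ∀ x, IsLocalization.liftAlgHom hφ (ι x) = φ x := fun x => IsLocalization.lift_eq _ _
  refine ⟨IsLocalization.liftAlgHom hφ, ?_, ?_⟩
  · ext i j
    exact (hl _).trans (by simp [φ])
  · ext
    exact (hl _).trans (by simp [φ])

theorem connectedSpace_coordStab (k : Type*) [Field k] [CharZero k] :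
    ConnectedSpace (PrimeSpectrum (CoordStab k)) := by
  have := isDomain_coordGLProd k
  obtain ⟨h, t, hgen⟩ := exists_gen_coordGLProd k
  -- φ is the comorphism of GL(2) × GL(1) → G_w, obtained by evaluating the map at the universal
  -- point.
  obtain ⟨φ, hφ, -⟩ :=
    (mem_stab_iff k (rho _ h * torus _ t)).1 (mul_mem (rho_mem_stab h) (torus_mem_stab t))
  have hsurj : Function.Surjective (PrimeSpectrum.comap φ.toRingHom) := by
    intro p
    let K := p.asIdeal.ResidueField
    let π : CoordStab k →ₐ[k] K := IsScalarTower.toAlgHom k (CoordStab k) K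
    have hg : G.map (π.comp (Ideal.Quotient.mkₐ k (stabIdeal k))).toRingHom (genG k) ∈ stab K := by
      rw [mem_stab_map_iff]
      intro a ha
      have : Ideal.Quotient.mkₐ k (stabIdeal k) a = 0 := Ideal.Quotient.eq_zero_iff_mem.2 ha
      change π (Ideal.Quotient.mkₐ k (stabIdeal k) a) = 0
      rw [this, map_zero]
    have h6 : IsUnit (6 : K) := by
      have : IsUnit (6 : k) := isUnit_iff_ne_zero.2 (by norm_num)
      have := this.map (algebraMap k K)
      rwa [map_ofNat] at this
    obtain ⟨h', t', e⟩ := exists_of_mem_stab h6 hg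
    obtain ⟨f, hf, hft⟩ := hgen K h' t'
    -- Both homomorphisms classify the same K-point of G_w. The kernel of f is therefore a prime
    -- lying over p.
    have hcomp : f.comp φ = π := by
      refine ((mem_stab_iff k _).1 hg).unique ?_ rfl
      rw [e, ← hf, ← hft, ← rho_map, ← torus_map, ← map_mul, ← hφ]
      rfl
    refine ⟨PrimeSpectrum.comap f.toRingHom ⊥, ?_⟩
    ext x
    change f (φ x) = 0 ↔ _
    rw [← AlgHom.comp_apply, hcomp]
    exact Ideal.algebraMap_residueField_eq_zero
  exact hsurj.connectedSpace (PrimeSpectrum.continuous_comap _)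

end PVS

theorem mainTheorem7 (k : Type*) [Field k] [CharZero k] :
    ConnectedSpace (PrimeSpectrum (PVS.CoordStab k)) ∧
      ∀ (R : Type*) [CommRing R] [Algebra k R],
        Function.Injective (PVS.rhoPGL R) ∧
          Function.Injective (PVS.prodHom R) ∧
            (PVS.prodHom R).range = MulAction.stabilizer (PVS.G R) (PVS.w R) := by
  refine ⟨PVS.connectedSpace_coordStab k, fun R _ _ => ?_⟩
  have hu : ∀ n : ℕ, n ≠ 0 → IsUnit (n : R) := fun n hn => by
    simpa using (isUnit_iff_ne_zero.2 (Nat.cast_ne_zero.2 hn : (n : k) ≠ 0)).map (algebraMap k R)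
  exact ⟨PVS.rhoPGL_injective (by exact_mod_cast hu 2 two_ne_zero), PVS.prodHom_injective R,
    PVS.range_prodHom (by exact_mod_cast hu 6 (by norm_num))⟩
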